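/- Let $\tfrac12<H<1$ and $\tfrac12<\alpha<H$, let $a\le b$ be real numbers and $I=[a,b]$, and let $W=(W_t)_{t\in\mathbb{R}}$ be a $d$-dimensional fractional Brownian motion with Hurst index $H$ on a probability space $(\Omega,\mathcal F,\mathbb P)$; that is, its components are independent centred Gaussian processes with covariance $\tfrac12\left(|s|^{2H}+|t|^{2H}-|t-s|^{2H}\right)$ and almost surely continuous paths. Let $\sigma\in C_b^3(\mathbb{R}^m;\mathbb{R}^{m\times d})$, i.e. $\sigma$ is three times continuously differentiable and $\sigma, D\sigma, D^2\sigma, D^3\sigma$ are bounded. Then for almost every $\omega\in\Omega$ and every initial value $y_a\in\mathbb{R}^m$ the pure Young differential equation $$dy_t=\sigma(y_t)\,dW_t(\omega),\quad t\in[a,b],$$ with initial value $y_a$ has a unique solution in the space $C^{\alpha}(I;\mathbb{R}^m)$ of $\alpha$-Hölder continuous paths. Here a solution is a path $y$ with $$y_t=y_a+\int_a^t\sigma(y_r)\,dW_r(\omega)\quad\text{for all } t\in[a,b],$$ where the Young integral is the limit, required to exist, of the sums $\sum_{[u,v]\in\mathcal P}\sigma(y_u)\,(W_v(\omega)-W_u(\omega))$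 over finite partitions $\mathcal P$ of $[a,t]$ as the mesh of $\mathcal P$ tends to $0$. -/

import Mathlib

open MeasureTheory ProbabilityTheory Set
open scoped NNReal

/-- A real fractional Brownian motion with Hurst index `H`, indexed by the whole real line:
a centred Gaussian process with covariance `(|s|^(2H) + |t|^(2H) - |t - s|^(2H)) / 2`,
almost all of whose sample paths are continuous. -/
structure IsRealFBM {Ω : Type*} [MeasurableSpace Ω] (H : ℝ) (X : ℝ → Ω → ℝ) (P : Measure Ω) :
    Prop where
  gaussian : IsGaussianProcess X P
  centred : ∀ t, ∫ ω, X t ω ∂P = 0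
  covariance_eq : ∀ s t, cov[X s, X t; P] =
    (|s| ^ (2 * H) + |t| ^ (2 * H) - |t - s| ^ (2 * H)) / 2
  continuous_paths : ∀ᵐ ω ∂P, Continuous fun t => X t ω

/-- A `d`-dimensional fractional Brownian motion with Hurst index `H`: its components are
independent real fractional Brownian motions with Hurst index `H`. -/
structure IsFBM {Ω : Type*} [MeasurableSpace Ω] {d : ℕ} (H : ℝ)
    (B : ℝ → Ω → EuclideanSpace ℝ (Fin d)) (P : Measure Ω) : Prop where
  component : ∀ i : Fin d, IsRealFBM H (fun t ω => B t ω i) P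
  independent : iIndepFun (fun (i : Fin d) (ω : Ω) (t : ℝ) => B t ω i) P

/-- `u 0 < u 1 < ⋯ < u n` is a finite partition of `[s, t]`
(only the first `n + 1` values of `u` matter). -/
structure IsPartition (s t : ℝ) (n : ℕ) (u : ℕ → ℝ) : Prop where
  first : u 0 = s
  last : u n = t
  lt : ∀ i < n, u i < u (i + 1)

/-- The left-point Riemann–Stieltjes sum `∑ yᵤ (xᵥ - xᵤ)` over the intervals `[u, v]` of a
partition. -/
def youngSum {V E : Type*} [NormedAddCommGroup V] [NormedSpace ℝ V] [NormedAddCommGroup E]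
    [NormedSpace ℝ E] (y : ℝ → V →L[ℝ] E) (x : ℝ → V) (n : ℕ) (u : ℕ → ℝ) : E :=
  ∑ i ∈ Finset.range n, y (u i) (x (u (i + 1)) - x (u i))

/-- The Young integral `∫ₛᵗ yᵣ dxᵣ` exists and equals `J`: the left-point sums over the finite
partitions of `[s, t]` converge to `J` as the mesh of the partition tends to `0`. -/
def HasYoungIntegral {V E : Type*} [NormedAddCommGroup V] [NormedSpace ℝ V]
    [NormedAddCommGroup E] [NormedSpace ℝ E] (y : ℝ → V →L[ℝ] E) (x : ℝ → V) (s t : ℝ) (J : E) :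
    Prop :=
  ∀ ε > 0, ∃ δ > 0, ∀ (n : ℕ) (u : ℕ → ℝ), IsPartition s t n u →
    (∀ i < n, u (i + 1) - u i < δ) → ‖youngSum y x n u - J‖ < ε

/-- `y` is `α`-Hölder continuous on `[a, b]`, that is, `y ∈ C^α([a, b]; E)`. -/
def IsHolderPath {E : Type*} [NormedAddCommGroup E] (α : ℝ≥0) (a b : ℝ) (y : ℝ → E) : Prop :=
  ∃ C : ℝ≥0, HolderOnWith C α y (Icc a b)

/-- `y` solves the pure Young differential equation `dy = σ(y) dx` on `[a, b]` with `y_a = ξ`. -/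
structure IsYoungSolution {V E : Type*} [NormedAddCommGroup V] [NormedSpace ℝ V]
    [NormedAddCommGroup E] [NormedSpace ℝ E] (σ : E → V →L[ℝ] E) (x : ℝ → V) (a b : ℝ) (ξ : E)
    (y : ℝ → E) : Prop where
  initial : y a = ξ
  integral_eq : ∀ t ∈ Icc a b, HasYoungIntegral (fun r => σ (y r)) x a t (y t - ξ)

/-- `σ ∈ C_b³`: three times continuously differentiable, and bounded together with its
derivatives up to order three. -/
def IsCb3 {E F : Type*} [NormedAddCommGroup E] [NormedSpace ℝ E] [NormedAddCommGroup F]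
    [NormedSpace ℝ F] (σ : E → F) : Prop :=
  ContDiff ℝ 3 σ ∧ ∃ C : ℝ, ∀ k ≤ 3, ∀ x, ‖iteratedFDeriv ℝ k σ x‖ ≤ C

/-! Probability enters only through path regularity: almost every path of `B` is `α`-Hölder on `[a,
b]`, because increments are Gaussian with variance `|t - s| ^ (2 * H)` and `α < H`
(`IsRealFBM.ae_exists_holderBound`). On this event everything is deterministic, so the null set does
not depend on the initial value.

Since `2 * α > 1`, the germ `y s (x t - x s)` is additive up to an error of order `(t - s) ^ (2 *
α)`, and bisecting partitions (`bisection_bound`) turns this into bounds independent of the number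
of points.

Uniqueness: on a short interval where two solutions start together, the Young estimate halves any
Hölder constant of their difference (`HolderBound.half_of_young`). Iteration makes the difference
zero, and intervals of fixed length cover `[a, b]`.

Existence: the bisection also bounds the remainder of the Euler schemes uniformly in the grid
(`eulerScheme_remainder_le`). A pointwise limit along an ultrafilter inherits this bound, and a path
whose increments match the germ to order `2 * α > 1` is automatically its own Young integral
(`hasYoungIntegral_of_local`). -/

/-- `y` is Hölder continuous on `[a, b]` with real exponent `α` and constant `L`. -/
def HolderBound {E : Type*} [NormedAddCommGroup E] (α L a b : ℝ) (y : ℝ → E) : Prop :=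
  ∀ s t, a ≤ s → s ≤ t → t ≤ b → ‖y t - y s‖ ≤ L * (t - s) ^ α

/-! ### Discrete sewing by bisection -/

/-- The constant in the sewing estimate with exponent `θ`. -/
noncomputable def sewingConst (θ : ℝ) : ℝ := 2 / (1 - 2 * (1 / 2 : ℝ) ^ θ)

theorem two_mul_half_rpow_lt_one {θ : ℝ} (hθ : 1 < θ) : 2 * (1 / 2 : ℝ) ^ θ < 1 := by
  have := Real.rpow_lt_rpow_of_exponent_gt (x := 1 / 2) (by norm_num) (by norm_num) hθ
  rw [Real.rpow_one] at this
  linarith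

theorem sewingConst_nonneg {θ : ℝ} (hθ : 1 < θ) : 0 ≤ sewingConst θ :=
  div_nonneg two_pos.le (by linarith [two_mul_half_rpow_lt_one hθ])

/-- The constant is the fixed point of the bisection recursion `C ↦ 2 * D + 2 * C * (1 / 2) ^ θ`:
two joining errors plus two halves. -/
theorem sewingConst_eq {θ : ℝ} (hθ : 1 < θ) (D : ℝ) :
    2 * D + 2 * (sewingConst θ * D) * (1 / 2 : ℝ) ^ θ = sewingConst θ * D := by
  have h : 1 - 2 * (1 / 2 : ℝ) ^ θ ≠ 0 := by linarith [two_mul_half_rpow_lt_one hθ]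
  have : sewingConst θ * (1 - 2 * (1 / 2 : ℝ) ^ θ) = 2 := div_mul_cancel₀ _ h
  linear_combination (-D) * this

/-- The step from `l` to `l + 1` is the one crossing the midpoint; removing it leaves two pieces of
at most half the length, however uneven the grid. -/
theorem exists_midpoint_index {u : ℕ → ℝ} (hu : Monotone u) {i j : ℕ} (hij : i < j) :
    ∃ l, i ≤ l ∧ l < j ∧ u l - u i ≤ (u j - u i) / 2 ∧ u j - u (l + 1) ≤ (u j - u i) / 2 := by
  classical
  have hex : ∃ m, i < m ∧ ((u j - u i) / 2 < u m - u i ∨ j ≤ m) := ⟨j, hij, Or.inr le_rfl⟩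
  have hnn : 0 ≤ u j - u i := sub_nonneg.2 (hu hij.le)
  obtain ⟨hm1, hm2⟩ := Nat.find_spec hex
  have hmin : ∀ m' < Nat.find hex, ¬ _ := fun m' h => Nat.find_min hex h
  have hmj : Nat.find hex ≤ j := Nat.find_min' hex ⟨hij, Or.inr le_rfl⟩
  generalize Nat.find hex = m at *
  obtain ⟨l, rfl⟩ : ∃ l, m = l + 1 := ⟨m - 1, by omega⟩
  refine ⟨l, by omega, by omega, ?_, ?_⟩
  · rcases (show i ≤ l by omega).eq_or_lt with h | h
    · subst h; rw [sub_self]; linarith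
    · by_contra hc
      exact hmin l (by omega) ⟨h, Or.inl (by linarith)⟩
  · rcases hm2 with h | h
    · linarith
    · have : j = l + 1 := by omega
      subst this; rw [sub_self]; linarith

/-- Sewing estimate along a partition, by splitting at the midpoint. -/
theorem bisection_bound {u : ℕ → ℝ} (hu : Monotone u) {R : ℕ → ℕ → ℝ} {θ C D T : ℝ}
    (hθ : 1 < θ) (hD : 0 ≤ D) (hC : 0 ≤ C) (hCD : 2 * D + 2 * C * (1 / 2 : ℝ) ^ θ ≤ C)
    (h0 : ∀ i, R i i ≤ 0) (h1 : ∀ i, R i (i + 1) ≤ 0)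
    (hR : ∀ i l j, i ≤ l → l ≤ j → u j - u i ≤ T → R i l ≤ C * (u l - u i) ^ θ →
      R i j ≤ R i l + R l j + D * (u j - u i) ^ θ) :
    ∀ i j, i ≤ j → u j - u i ≤ T → R i j ≤ C * (u j - u i) ^ θ := by
  have hpos : ∀ {i j : ℕ}, i ≤ j → 0 ≤ u j - u i := fun h => sub_nonneg.2 (hu h)
  suffices H : ∀ k i j, j - i = k → i ≤ j → u j - u i ≤ T → R i j ≤ C * (u j - u i) ^ θ from
    fun i j => H (j - i) i j rfl
  intro k
  induction k using Nat.strong_induction_on with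
  | _ k ih =>
    intro i j hk hij hT
    rcases hij.eq_or_lt with rfl | hlt
    · exact (h0 i).trans (mul_nonneg hC (Real.rpow_nonneg (hpos le_rfl) _))
    obtain ⟨l, hil, hlj, hl1, hl2⟩ := exists_midpoint_index hu hlt
    have mil := hu hil
    have mlj := hu (show l + 1 ≤ j from hlj)
    have mll := hu (Nat.le_succ l)
    simp only [Nat.succ_eq_add_one] at mll
    have half : ∀ r : ℝ, 0 ≤ r → r ≤ (u j - u i) / 2 →
        C * r ^ θ ≤ C * (1 / 2 : ℝ) ^ θ * (u j - u i) ^ θ := by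
      intro r hr hr2
      rw [mul_assoc, ← Real.mul_rpow (by norm_num) (hpos hij)]
      exact mul_le_mul_of_nonneg_left
        (Real.rpow_le_rpow hr (by linarith) (by linarith)) hC
    -- The range is cut at `l` and at `l + 1`; the crossing step has nonpositive `R`. The bound on
    -- each left piece is what `hR` demands before it may be applied.
    have e1 := ih (l - i) (by omega) i l rfl hil (by linarith)
    have e2 := ih (j - (l + 1)) (by omega) (l + 1) j rfl hlj (by linarith)
    have f1 := hR i l j hil hlj.le hT e1
    have f2 := hR l (l + 1) j (by omega) hlj (by linarith)
      ((h1 l).trans (mul_nonneg hC (Real.rpow_nonneg (hpos (by omega)) _)))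
    have g1 := half _ (hpos hil) hl1
    have g2 := half _ (hpos hlj) hl2
    have g3 : D * (u j - u l) ^ θ ≤ D * (u j - u i) ^ θ :=
      mul_le_mul_of_nonneg_left
        (Real.rpow_le_rpow (hpos hlj.le) (by linarith) (by linarith)) hD
    have g4 := mul_le_mul_of_nonneg_right hCD (Real.rpow_nonneg (hpos hij) θ)
    have := h1 l
    nlinarith

/-! ### Young integrals -/

section Young

variable {V E : Type*} [NormedAddCommGroup V] [NormedSpace ℝ V]
  [NormedAddCommGroup E] [NormedSpace ℝ E]

theorem IsPartition.monotone_min {s t : ℝ} {n : ℕ} {u : ℕ → ℝ} (h : IsPartition s t n u) :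
    Monotone fun k => u (min k n) := by
  refine monotone_nat_of_le_succ fun k => ?_
  rcases lt_or_ge k n with hk | hk
  · rw [min_eq_left hk.le, min_eq_left (show k + 1 ≤ n from hk)]
    exact (h.lt k hk).le
  · rw [min_eq_right hk, min_eq_right (by omega)]

theorem IsPartition.mem {s t : ℝ} {n : ℕ} {u : ℕ → ℝ} (h : IsPartition s t n u) {k : ℕ}
    (hk : k ≤ n) : s ≤ u k ∧ u k ≤ t := by
  have h0 := h.monotone_min (Nat.zero_le k)
  have h1 := h.monotone_min hk
  simp only [Nat.zero_min, min_eq_left hk, min_self, h.first, h.last] at h0 h1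
  exact ⟨h0, h1⟩

/-- Young–Loève estimate: splitting `[i, j]` at `l` changes the germ by `(y l - y i) (x j - x l)`,
of size at most `L * K * (j - i) ^ (2 * α)`. -/
theorem norm_youngSum_sub_le {y : ℝ → V →L[ℝ] E} {x : ℝ → V} {α K L s t : ℝ} (hα : 1 / 2 < α)
    (hK : 0 ≤ K) (hL : 0 ≤ L) (hy : HolderBound α L s t y) (hx : HolderBound α K s t x)
    {n : ℕ} {u : ℕ → ℝ} (hu : IsPartition s t n u) :
    ‖youngSum y x n u - y s (x t - x s)‖ ≤ sewingConst (2 * α) * (L * K) * (t - s) ^ (2 * α) := by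
  -- Freezing the partition after index `n` makes it monotone on all of `ℕ`.
  set v : ℕ → ℝ := fun k => u (min k n) with hv
  have hmono : Monotone v := hu.monotone_min
  have hmem : ∀ k, s ≤ v k ∧ v k ≤ t := fun k => hu.mem (min_le_right _ _)
  have hθ : 1 < 2 * α := by linarith
  have key := bisection_bound hmono (R := fun i j =>
    ‖∑ k ∈ Finset.Ico i j, y (v k) (x (v (k + 1)) - x (v k)) - y (v i) (x (v j) - x (v i))‖)
    (θ := 2 * α) (C := sewingConst (2 * α) * (L * K)) (D := L * K) (T := t - s) hθ
    (mul_nonneg hL hK) (mul_nonneg (sewingConst_nonneg hθ) (mul_nonneg hL hK))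
    (sewingConst_eq hθ _).le (by simp) (by simp) ?_ 0 n (Nat.zero_le n)
    (by linarith [(hmem 0).1, (hmem n).2])
  · have h0 : v 0 = s := by simp [hv, hu.first]
    have hn : v n = t := by simp [hv, hu.last]
    rw [h0, hn] at key
    convert key using 3
    rw [youngSum, Finset.range_eq_Ico]
    refine Finset.sum_congr rfl fun k hk => ?_
    have hk := (Finset.mem_Ico.1 hk).2
    simp only [hv]
    rw [min_eq_left hk.le, min_eq_left (show k + 1 ≤ n from hk)]
  · intro i l j hil hlj _ _
    have e : ∑ k ∈ Finset.Ico i j, y (v k) (x (v (k + 1)) - x (v k)) - y (v i) (x (v j) - x (v i))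
        = (∑ k ∈ Finset.Ico i l, y (v k) (x (v (k + 1)) - x (v k)) - y (v i) (x (v l) - x (v i)))
        + (∑ k ∈ Finset.Ico l j, y (v k) (x (v (k + 1)) - x (v k)) - y (v l) (x (v j) - x (v l)))
        + (y (v l) - y (v i)) (x (v j) - x (v l)) := by
      rw [← Finset.sum_Ico_consecutive _ hil hlj]
      simp only [map_sub, sub_apply]
      abel
    simp only [e]
    refine (norm_add₃_le).trans ?_
    gcongr
    have h1 := hy (v i) (v l) (hmem _).1 (hmono hil) (hmem _).2
    have h2 := hx (v l) (v j) (hmem _).1 (hmono hlj) (hmem _).2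
    have m1 := hmono hil
    have m2 := hmono hlj
    calc _ ≤ ‖y (v l) - y (v i)‖ * ‖x (v j) - x (v l)‖ := ContinuousLinearMap.le_opNorm _ _
      _ ≤ (L * (v l - v i) ^ α) * (K * (v j - v l) ^ α) := by gcongr
      _ ≤ (L * (v j - v i) ^ α) * (K * (v j - v i) ^ α) := by
        have : 0 ≤ v l - v i := by linarith
        have : 0 ≤ v j - v l := by linarith
        have : 0 ≤ v j - v i := by linarith
        gcongr
      _ = _ := by
        rw [two_mul, Real.rpow_add_of_nonneg (by linarith) (by linarith) (by linarith)]
        ring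

theorem exists_isPartition {s t δ : ℝ} (hst : s ≤ t) (hδ : 0 < δ) :
    ∃ n u, IsPartition s t n u ∧ ∀ i < n, u (i + 1) - u i < δ := by
  rcases hst.eq_or_lt with rfl | hlt
  · exact ⟨0, fun _ => s, ⟨rfl, rfl, by simp⟩, by simp⟩
  obtain ⟨n, hn⟩ := exists_nat_gt ((t - s) / δ)
  have hn0 : (0 : ℝ) < n := (div_pos (sub_pos.2 hlt) hδ).trans hn
  have hstep : ∀ i : ℕ, (s + ((i + 1 : ℕ) : ℝ) * ((t - s) / n)) - (s + i * ((t - s) / n))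
      = (t - s) / n := by
    intro i; push_cast; ring
  refine ⟨n, fun i => s + i * ((t - s) / n), ⟨by simp, by field_simp; ring, ?_⟩, ?_⟩
  · intro i _
    have := hstep i
    have h2 : 0 < (t - s) / n := div_pos (sub_pos.2 hlt) hn0
    linarith
  · intro i _
    simp only [hstep i]
    rw [div_lt_iff₀ hδ] at hn
    rw [div_lt_iff₀ hn0]
    linarith

theorem IsPartition.append {r s t : ℝ} {n m : ℕ} {u v : ℕ → ℝ} (hu : IsPartition r s n u)
    (hv : IsPartition s t m v) :
    IsPartition r t (n + m) (fun k => if k ≤ n then u k else v (k - n)) where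
  first := by simp [hu.first]
  last := by
    rcases Nat.eq_zero_or_pos m with rfl | hm
    · have := hv.first; have := hv.last; have := hu.last
      simp; linarith
    · simp [hm.ne', hv.last]
  lt i hi := by
    rcases lt_trichotomy i n with h | h | h
    · simp only [h.le, if_true, show i + 1 ≤ n from h]; exact hu.lt i h
    · subst h
      have := hv.lt 0 (by omega)
      rw [hv.first, ← hu.last] at this
      simpa using this
    · have := hv.lt (i - n) (by omega)
      simpa [show ¬ i ≤ n by omega, show ¬ i + 1 ≤ n by omega,
        show i + 1 - n = i - n + 1 by omega] using this

theorem append_eq_right {s : ℝ} {n : ℕ} {u v : ℕ → ℝ} (hu : u n = s) (hv : v 0 = s) (k : ℕ) :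
    (if n + k ≤ n then u (n + k) else v (n + k - n)) = v k := by
  rcases Nat.eq_zero_or_pos k with rfl | hk
  · simp [hu, hv]
  · simp [hk.ne']

theorem youngSum_append (y : ℝ → V →L[ℝ] E) (x : ℝ → V) {s : ℝ} {n m : ℕ} {u v : ℕ → ℝ}
    (hu : u n = s) (hv : v 0 = s) :
    youngSum y x (n + m) (fun k => if k ≤ n then u k else v (k - n)) =
      youngSum y x n u + youngSum y x m v := by
  rw [youngSum, Finset.sum_range_add]
  congr 1
  · refine Finset.sum_congr rfl fun k hk => ?_
    have := Finset.mem_range.1 hk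
    simp [this.le, show k + 1 ≤ n from this]
  · refine Finset.sum_congr rfl fun k _ => ?_
    rw [add_assoc, append_eq_right hu hv, append_eq_right hu hv]

theorem mesh_append_lt {s δ : ℝ} {n m : ℕ} {u v : ℕ → ℝ} (hu : u n = s) (hv : v 0 = s)
    (h1 : ∀ i < n, u (i + 1) - u i < δ) (h2 : ∀ i < m, v (i + 1) - v i < δ) :
    ∀ i < n + m, (fun k => if k ≤ n then u k else v (k - n)) (i + 1) -
      (fun k => if k ≤ n then u k else v (k - n)) i < δ := by
  intro i hi
  rcases lt_or_ge i n with h | h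
  · simpa [h.le, show i + 1 ≤ n from h] using h1 i h
  · obtain ⟨k, rfl⟩ := Nat.exists_eq_add_of_le h
    beta_reduce
    rw [add_assoc, append_eq_right hu hv, append_eq_right hu hv]
    exact h2 k (by omega)

/-- Every fine partition of `[s, t]` extends to a fine partition of `[r, t]` by prefixing one of
`[r, s]`. -/
theorem HasYoungIntegral.sub_left {y : ℝ → V →L[ℝ] E} {x : ℝ → V} {r s t : ℝ} {J₁ J₂ : E}
    (hrs : r ≤ s) (h₁ : HasYoungIntegral y x r s J₁) (h₂ : HasYoungIntegral y x r t J₂) :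
    HasYoungIntegral y x s t (J₂ - J₁) := by
  intro ε hε
  obtain ⟨δ₁, hδ₁, H₁⟩ := h₁ (ε / 2) (half_pos hε)
  obtain ⟨δ₂, hδ₂, H₂⟩ := h₂ (ε / 2) (half_pos hε)
  refine ⟨min δ₁ δ₂, lt_min hδ₁ hδ₂, fun m v hv hm => ?_⟩
  obtain ⟨n, u, hu, hn⟩ := exists_isPartition hrs (lt_min hδ₁ hδ₂)
  have A := H₁ n u hu fun i hi => (hn i hi).trans_le (min_le_left _ _)
  have B := H₂ _ _ (hu.append hv) fun i hi =>
    (mesh_append_lt hu.last hv.first hn hm i hi).trans_le (min_le_right _ _)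
  rw [youngSum_append y x hu.last hv.first] at B
  calc ‖youngSum y x m v - (J₂ - J₁)‖
      = ‖(youngSum y x n u + youngSum y x m v - J₂) - (youngSum y x n u - J₁)‖ := by congr 1; abel
    _ ≤ _ := norm_sub_le _ _
    _ < ε := by linarith

theorem HasYoungIntegral.sub {y z : ℝ → V →L[ℝ] E} {x : ℝ → V} {s t : ℝ} {J₁ J₂ : E}
    (h₁ : HasYoungIntegral y x s t J₁) (h₂ : HasYoungIntegral z x s t J₂) :
    HasYoungIntegral (fun r => y r - z r) x s t (J₁ - J₂) := by
  intro ε hε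
  obtain ⟨δ₁, hδ₁, H₁⟩ := h₁ (ε / 2) (half_pos hε)
  obtain ⟨δ₂, hδ₂, H₂⟩ := h₂ (ε / 2) (half_pos hε)
  refine ⟨min δ₁ δ₂, lt_min hδ₁ hδ₂, fun n u hu hn => ?_⟩
  have A := H₁ n u hu fun i hi => (hn i hi).trans_le (min_le_left _ _)
  have B := H₂ n u hu fun i hi => (hn i hi).trans_le (min_le_right _ _)
  have e : youngSum (fun r => y r - z r) x n u = youngSum y x n u - youngSum z x n u := by
    simp [youngSum, Finset.sum_sub_distrib]
  calc _ = ‖(youngSum y x n u - J₁) - (youngSum z x n u - J₂)‖ := by rw [e]; congr 1; abel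
    _ ≤ _ := norm_sub_le _ _
    _ < ε := by linarith

theorem HasYoungIntegral.norm_sub_le {y : ℝ → V →L[ℝ] E} {x : ℝ → V} {α K L s t : ℝ} {J : E}
    (h : HasYoungIntegral y x s t J) (hst : s ≤ t) (hα : 1 / 2 < α)
    (hK : 0 ≤ K) (hL : 0 ≤ L) (hy : HolderBound α L s t y) (hx : HolderBound α K s t x) :
    ‖J - y s (x t - x s)‖ ≤ sewingConst (2 * α) * (L * K) * (t - s) ^ (2 * α) := by
  refine le_of_forall_pos_le_add fun ε hε => ?_
  obtain ⟨δ, hδ, H⟩ := h ε hε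
  obtain ⟨n, u, hu, hn⟩ := exists_isPartition hst hδ
  have A := H n u hu hn
  have B := norm_youngSum_sub_le hα hK hL hy hx hu
  calc ‖J - y s (x t - x s)‖
      = ‖(youngSum y x n u - y s (x t - x s)) - (youngSum y x n u - J)‖ := by congr 1; abel
    _ ≤ _ := _root_.norm_sub_le _ _
    _ ≤ _ := by linarith

/-- With mesh below `η`, the local errors add up to at most `C * η ^ (θ - 1) * (b - a)`, which
vanishes with `η`. The integral thus exists with a known value, without a separate construction. -/
theorem hasYoungIntegral_of_local {y : ℝ → V →L[ℝ] E} {x : ℝ → V} {g : ℝ → E} {θ C T a b : ℝ}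
    (hθ : 1 < θ) (hC : 0 ≤ C) (hT : 0 < T)
    (hg : ∀ s t, a ≤ s → s ≤ t → t ≤ b → t - s < T →
      ‖g t - g s - y s (x t - x s)‖ ≤ C * (t - s) ^ θ) :
    HasYoungIntegral y x a b (g b - g a) := by
  intro ε hε
  obtain ⟨η, hη, hη2⟩ : ∃ η : ℝ, 0 < η ∧ C * η ^ (θ - 1) * (b - a) < ε := by
    have : Filter.Tendsto (fun η : ℝ => C * η ^ (θ - 1) * (b - a)) (nhdsWithin 0 (Ioi 0))
        (nhds (C * (0 : ℝ) ^ (θ - 1) * (b - a))) := by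
      refine Filter.Tendsto.mono_left ?_ nhdsWithin_le_nhds
      exact ((Real.continuousAt_rpow_const 0 (θ - 1) (Or.inr (by linarith))).const_mul C).mul_const _
    rw [Real.zero_rpow (by linarith), mul_zero, zero_mul] at this
    obtain ⟨η, h1, h2⟩ := ((this.eventually (gt_mem_nhds hε)).and self_mem_nhdsWithin).exists
    exact ⟨η, h2, h1⟩
  refine ⟨min η T, lt_min hη hT, fun n u hu hn => ?_⟩
  have hmesh : ∀ i < n, u (i + 1) - u i < η ∧ u (i + 1) - u i < T := fun i hi =>
    ⟨(hn i hi).trans_le (min_le_left _ _), (hn i hi).trans_le (min_le_right _ _)⟩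
  have htel : g b - g a = ∑ i ∈ Finset.range n, (g (u (i + 1)) - g (u i)) := by
    rw [Finset.sum_range_sub (fun i => g (u i)), hu.first, hu.last]
  have htel2 : b - a = ∑ i ∈ Finset.range n, (u (i + 1) - u i) := by
    rw [Finset.sum_range_sub, hu.first, hu.last]
  have hbound : ∀ i ∈ Finset.range n, ‖g (u (i + 1)) - g (u i) - y (u i) (x (u (i + 1)) - x (u i))‖
      ≤ C * η ^ (θ - 1) * (u (i + 1) - u i) := by
    intro i hi
    have hi := Finset.mem_range.1 hi
    have hpos : 0 < u (i + 1) - u i := sub_pos.2 (hu.lt i hi)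
    refine (hg _ _ (hu.mem hi.le).1 (hu.lt i hi).le (hu.mem (show i + 1 ≤ n from hi)).2
      (hmesh i hi).2).trans ?_
    rw [mul_assoc]
    refine mul_le_mul_of_nonneg_left ?_ hC
    calc (u (i + 1) - u i) ^ θ = (u (i + 1) - u i) ^ (θ - 1) * (u (i + 1) - u i) := by
          rw [← Real.rpow_add_one hpos.ne', sub_add_cancel]
      _ ≤ _ := mul_le_mul_of_nonneg_right
          (Real.rpow_le_rpow hpos.le (hmesh i hi).1.le (by linarith)) hpos.le
  calc ‖youngSum y x n u - (g b - g a)‖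
      = ‖∑ i ∈ Finset.range n, (g (u (i + 1)) - g (u i) - y (u i) (x (u (i + 1)) - x (u i)))‖ := by
        rw [norm_sub_rev, htel, youngSum, ← Finset.sum_sub_distrib]
    _ ≤ ∑ i ∈ Finset.range n, C * η ^ (θ - 1) * (u (i + 1) - u i) := norm_sum_le_of_le _ hbound
    _ = C * η ^ (θ - 1) * (b - a) := by rw [← Finset.mul_sum, ← htel2]
    _ < ε := hη2

end Young

theorem exists_mul_rpow_le {α A ε : ℝ} (hα : 0 < α) (hε : 0 < ε) :
    ∃ T : ℝ, 0 < T ∧ T ≤ 1 ∧ A * T ^ α ≤ ε := by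
  have : Filter.Tendsto (fun η : ℝ => A * η ^ α) (nhdsWithin 0 (Ioi 0))
      (nhds (A * (0 : ℝ) ^ α)) := by
    refine Filter.Tendsto.mono_left ?_ nhdsWithin_le_nhds
    exact (Real.continuousAt_rpow_const 0 α (Or.inr hα.le)).const_mul A
  rw [Real.zero_rpow hα.ne', mul_zero] at this
  obtain ⟨η, ⟨h1, h2⟩, h3⟩ := ((this.eventually (gt_mem_nhds hε)).and self_mem_nhdsWithin).and
    (mem_nhdsWithin_of_mem_nhds (gt_mem_nhds one_pos)) |>.exists
  exact ⟨η, h2, le_of_lt h3, h1.le⟩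

theorem HolderBound.mono {E : Type*} [NormedAddCommGroup E] {α L a b c d : ℝ} {y : ℝ → E} (h : HolderBound α L a b y) (hac : a ≤ c)
    (hdb : d ≤ b) : HolderBound α L c d y :=
  fun s t hs hst ht => h s t (hac.trans hs) hst (ht.trans hdb)

/-! ### Coefficient bounds and uniqueness -/

section

variable {V E : Type*} [NormedAddCommGroup V] [NormedSpace ℝ V]
  [NormedAddCommGroup E] [NormedSpace ℝ E]

/-- Bounds for a coefficient with bounded derivatives up to order two. -/
structure CoeffBound (σ : E → V →L[ℝ] E) (L : ℝ) : Prop where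
  nonneg : 0 ≤ L
  norm_le : ∀ p, ‖σ p‖ ≤ L
  lipschitz : ∀ p q, ‖σ p - σ q‖ ≤ L * ‖p - q‖
  diff : ∀ p q p' q', ‖(σ p - σ q) - (σ p' - σ q')‖ ≤
    L * ‖(p - q) - (p' - q')‖ + L * ‖p' - q'‖ * ‖q - q'‖

/-- For the second difference put `w = p' - q'` and insert `σ (q + w)`: the Lipschitz bound handles
`σ p - σ (q + w)`, and `x ↦ σ (x + w) - σ x` has derivative at most `C * ‖w‖`. -/
theorem IsCb3.exists_bounds {F : Type*} [NormedAddCommGroup F] [NormedSpace ℝ F] {σ : E → F}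
    (hσ : IsCb3 σ) : ∃ C, 0 ≤ C ∧ (∀ p, ‖σ p‖ ≤ C) ∧ (∀ p q, ‖σ p - σ q‖ ≤ C * ‖p - q‖) ∧
      ∀ p q p' q', ‖(σ p - σ q) - (σ p' - σ q')‖ ≤
        C * ‖(p - q) - (p' - q')‖ + C * ‖p' - q'‖ * ‖q - q'‖ := by
  obtain ⟨hc, C, hC⟩ := hσ
  have hdiff : Differentiable ℝ σ := hc.differentiable (by norm_num)
  have hdiff2 : Differentiable ℝ (fderiv ℝ σ) :=
    (hc.fderiv_right (m := 2) (by norm_num)).differentiable (by norm_num)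
  have b0 : ∀ p, ‖σ p‖ ≤ C := fun p => by simpa using hC 0 (by norm_num) p
  have b1 : ∀ p, ‖fderiv ℝ σ p‖ ≤ C := fun p => by
    simpa [norm_iteratedFDeriv_one] using hC 1 (by norm_num) p
  have b2 : ∀ p, ‖fderiv ℝ (fderiv ℝ σ) p‖ ≤ C := fun p => by
    rw [← norm_iteratedFDeriv_one, norm_iteratedFDeriv_fderiv]
    exact hC 2 (by norm_num) p
  have l1 : ∀ p q, ‖σ p - σ q‖ ≤ C * ‖p - q‖ := fun p q =>
    convex_univ.norm_image_sub_le_of_norm_fderiv_le (fun x _ => hdiff x) (fun x _ => b1 x)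
      (mem_univ q) (mem_univ p)
  have l2 : ∀ p q, ‖fderiv ℝ σ p - fderiv ℝ σ q‖ ≤ C * ‖p - q‖ := fun p q =>
    convex_univ.norm_image_sub_le_of_norm_fderiv_le (fun x _ => hdiff2 x) (fun x _ => b2 x)
      (mem_univ q) (mem_univ p)
  refine ⟨C, (norm_nonneg _).trans (b0 0), b0, l1, fun p q p' q' => ?_⟩
  have hd : ∀ w x, HasFDerivAt (fun x => σ (x + w) - σ x) (fderiv ℝ σ (x + w) - fderiv ℝ σ x) x :=
    fun w x => ((hasFDerivAt_comp_add_right w).2 (hdiff (x + w)).hasFDerivAt).sub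
      (hdiff x).hasFDerivAt
  have l3 : ∀ w x x', ‖(σ (x + w) - σ x) - (σ (x' + w) - σ x')‖ ≤ C * ‖w‖ * ‖x - x'‖ :=
    fun w x x' => convex_univ.norm_image_sub_le_of_norm_hasFDerivWithin_le
      (f := fun x => σ (x + w) - σ x)
      (fun x _ => (hd w x).hasFDerivWithinAt) (fun x _ => by simpa using l2 (x + w) x)
      (mem_univ x') (mem_univ x)
  calc ‖(σ p - σ q) - (σ p' - σ q')‖
      = ‖(σ p - σ (q + (p' - q'))) + ((σ (q + (p' - q')) - σ q) -
          (σ (q' + (p' - q')) - σ q'))‖ := by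
        rw [add_sub_cancel q' p']; congr 1; abel
    _ ≤ _ := norm_add_le _ _
    _ ≤ _ := by
      refine add_le_add ((l1 _ _).trans (le_of_eq ?_)) (l3 _ _ _)
      congr 2; abel

theorem IsCb3.coeffBound {σ : E → V →L[ℝ] E} (hσ : IsCb3 σ) : ∃ L, CoeffBound σ L := by
  obtain ⟨C, h0, h1, h2, h3⟩ := hσ.exists_bounds
  exact ⟨C, h0, h1, h2, h3⟩

/-- The difference starts at zero, so its supremum is at most `M * T ^ α`. Hence `σ (y r) - σ (z r)`
has Hölder constant proportional to `M`, and the Young estimate returns `M` times a small power of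
`T`. -/
theorem HolderBound.half_of_young {σ : E → V →L[ℝ] E} {L : ℝ} (hσ : CoeffBound σ L)
    {x : ℝ → V} {y z : ℝ → E} {α K Cz M T a b : ℝ} (hα : 1 / 2 < α) (hK : 0 ≤ K) (hCz : 0 ≤ Cz)
    (hM : 0 ≤ M) (hT0 : 0 < T) (hT1 : T ≤ 1)
    (hT : (L * K + sewingConst (2 * α) * ((L + L * Cz) * K)) * T ^ α ≤ 1 / 2)
    (hx : HolderBound α K a b x) (hz : HolderBound α Cz a b z)
    (hw : HolderBound α M a b (fun t => y t - z t)) (h0 : y a = z a) (hba : b - a ≤ T)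
    (hint : ∀ s t, a ≤ s → s ≤ t → t ≤ b →
      HasYoungIntegral (fun r => σ (y r) - σ (z r)) x s t ((y t - z t) - (y s - z s))) :
    HolderBound α (M / 2) a b (fun t => y t - z t) := by
  have hL := hσ.nonneg
  have hTα : T ^ α ≤ 1 := Real.rpow_le_one hT0.le hT1 (by linarith)
  have hTα0 : 0 ≤ T ^ α := Real.rpow_nonneg hT0.le _
  have hc := sewingConst_nonneg (θ := 2 * α) (by linarith)
  have hws : ∀ s, a ≤ s → s ≤ b → ‖y s - z s‖ ≤ M * T ^ α := by
    intro s hs hsb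
    have := hw a s le_rfl hs hsb
    simp only [h0, sub_self, sub_zero] at this
    refine this.trans (mul_le_mul_of_nonneg_left ?_ hM)
    exact Real.rpow_le_rpow (by linarith) (by linarith) (by linarith)
  have hσw : HolderBound α (M * (L + L * Cz)) a b (fun r => σ (y r) - σ (z r)) := by
    intro s t hs hst ht
    have hh : 0 ≤ (t - s) ^ α := Real.rpow_nonneg (by linarith) _
    calc ‖(σ (y t) - σ (z t)) - (σ (y s) - σ (z s))‖
        ≤ L * ‖(y t - z t) - (y s - z s)‖ + L * ‖y s - z s‖ * ‖z t - z s‖ := hσ.diff _ _ _ _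
      _ ≤ L * (M * (t - s) ^ α) + L * (M * 1) * (Cz * (t - s) ^ α) := by
        gcongr
        · exact hw s t hs hst ht
        · exact (hws s hs (hst.trans ht)).trans (by gcongr)
        · exact hz s t hs hst ht
      _ = _ := by ring
  intro s t hs hst ht
  have hh : 0 ≤ (t - s) ^ α := Real.rpow_nonneg (by linarith) _
  have hhT : (t - s) ^ α ≤ T ^ α := Real.rpow_le_rpow (by linarith) (by linarith) (by linarith)
  have A := (hint s t hs hst ht).norm_sub_le hst hα hK
    (mul_nonneg hM (by positivity)) (hσw.mono hs ht) (hx.mono hs ht)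
  have B : ‖(σ (y s) - σ (z s)) (x t - x s)‖ ≤ (L * (M * T ^ α)) * (K * (t - s) ^ α) := by
    refine (ContinuousLinearMap.le_opNorm _ _).trans ?_
    gcongr
    · exact (hσ.lipschitz _ _).trans (by gcongr; exact hws s hs (hst.trans ht))
    · exact hx s t hs hst ht
  have e : (t - s) ^ (2 * α) = (t - s) ^ α * (t - s) ^ α := by
    rw [two_mul, Real.rpow_add_of_nonneg (by linarith) (by linarith) (by linarith)]
  calc ‖(y t - z t) - (y s - z s)‖
      ≤ ‖(y t - z t) - (y s - z s) - (σ (y s) - σ (z s)) (x t - x s)‖ +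
        ‖(σ (y s) - σ (z s)) (x t - x s)‖ := by
        simpa using norm_add_le ((y t - z t) - (y s - z s) - (σ (y s) - σ (z s)) (x t - x s))
          ((σ (y s) - σ (z s)) (x t - x s))
    _ ≤ sewingConst (2 * α) * (M * (L + L * Cz) * K) * ((t - s) ^ α * T ^ α) +
        (L * (M * T ^ α)) * (K * (t - s) ^ α) := by
        rw [e] at A
        refine add_le_add (A.trans ?_) B
        gcongr
    _ = ((L * K + sewingConst (2 * α) * ((L + L * Cz) * K)) * T ^ α) * (M * (t - s) ^ α) := by ring
    _ ≤ 1 / 2 * (M * (t - s) ^ α) := by gcongr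
    _ = M / 2 * (t - s) ^ α := by ring

theorem IsYoungSolution.eqOn {σ : E → V →L[ℝ] E} {L : ℝ} (hσ : CoeffBound σ L)
    {x : ℝ → V} {y z : ℝ → E} {ξ : E} {α K Cy Cz a b : ℝ} (hα : 1 / 2 < α) (hK : 0 ≤ K)
    (hCy : 0 ≤ Cy) (hCz : 0 ≤ Cz) (hx : HolderBound α K a b x) (hy : HolderBound α Cy a b y)
    (hz : HolderBound α Cz a b z) (hys : IsYoungSolution σ x a b ξ y)
    (hzs : IsYoungSolution σ x a b ξ z) : EqOn y z (Icc a b) := by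
  have hint1 : ∀ {y : ℝ → E}, IsYoungSolution σ x a b ξ y → ∀ s t, a ≤ s → s ≤ t → t ≤ b →
      HasYoungIntegral (fun r => σ (y r)) x s t (y t - y s) := by
    intro y h s t hs hst ht
    have := (h.integral_eq s ⟨hs, hst.trans ht⟩).sub_left hs (h.integral_eq t ⟨hs.trans hst, ht⟩)
    simpa using this
  have hint : ∀ s t, a ≤ s → s ≤ t → t ≤ b →
      HasYoungIntegral (fun r => σ (y r) - σ (z r)) x s t ((y t - z t) - (y s - z s)) := by
    intro s t hs hst ht
    have := (hint1 hys s t hs hst ht).sub (hint1 hzs s t hs hst ht)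
    rwa [show y t - y s - (z t - z s) = (y t - z t) - (y s - z s) by abel] at this
  have hw : HolderBound α (Cy + Cz) a b (fun t => y t - z t) := by
    intro s t hs hst ht
    calc ‖(y t - z t) - (y s - z s)‖ = ‖(y t - y s) - (z t - z s)‖ := by congr 1; abel
      _ ≤ _ := norm_sub_le _ _
      _ ≤ _ := add_le_add (hy s t hs hst ht) (hz s t hs hst ht)
      _ = _ := by ring
  -- `T` does not depend on the starting point of a window or on the constant being halved, so the
  -- same `T` serves every iteration and window.
  obtain ⟨T, hT0, hT1, hT⟩ := exists_mul_rpow_le (α := α)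
    (A := L * K + sewingConst (2 * α) * ((L + L * Cz) * K)) (by linarith) one_half_pos
  have step : ∀ s t, a ≤ s → s ≤ t → t ≤ b → t - s ≤ T → y s = z s → y t = z t := by
    intro s t hs hst ht htT h0
    have H : ∀ n : ℕ, HolderBound α ((Cy + Cz) * (1 / 2) ^ n) s t (fun t => y t - z t) := by
      intro n
      induction n with
      | zero => simpa using hw.mono hs ht
      | succ n ih =>
        have := HolderBound.half_of_young hσ hα hK hCz (by positivity) hT0 hT1 hT
          (hx.mono hs ht) (hz.mono hs ht) ih h0 htT
          fun s' t' h1 h2 h3 => hint s' t' (hs.trans h1) h2 (h3.trans ht)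
        rwa [mul_div_assoc, ← one_div_mul_eq_div, mul_comm (1 / 2 : ℝ), ← pow_succ] at this
    have lim : Filter.Tendsto (fun n : ℕ => (Cy + Cz) * (1 / 2 : ℝ) ^ n * (t - s) ^ α) Filter.atTop
        (nhds ((Cy + Cz) * 0 * (t - s) ^ α)) :=
      ((tendsto_pow_atTop_nhds_zero_of_lt_one (by norm_num) (by norm_num)).const_mul _).mul_const _
    have := ge_of_tendsto' lim fun n => H n s t le_rfl hst le_rfl
    simp only [mul_zero, zero_mul, h0, sub_self, sub_zero] at this
    exact sub_eq_zero.1 (norm_le_zero_iff.1 this)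
  have main : ∀ n : ℕ, ∀ t, a ≤ t → t ≤ b → t - a ≤ n * T → y t = z t := by
    intro n
    induction n with
    | zero =>
      intro t hat _ ht
      have : t = a := by
        have : t - a ≤ 0 := by simpa using ht
        linarith
      rw [this, hys.initial, hzs.initial]
    | succ n ih =>
      intro t hat htb ht
      rcases le_or_gt (t - a) (n * T) with h | h
      · exact ih t hat htb h
      · have hn : 0 ≤ n * T := by positivity
        push_cast at ht
        exact step (a + n * T) t (by linarith) (by linarith) htb (by linarith)
          (ih _ (by linarith) (by linarith) (by linarith))
  intro t ht
  obtain ⟨n, hn⟩ := exists_nat_ge ((t - a) / T)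
  exact main n t ht.1 ht.2 ((div_le_iff₀ hT0).1 hn)

end

/-! ### Existence by Euler schemes -/

section Euler

open Filter Topology

variable {V E : Type*} [NormedAddCommGroup V] [NormedSpace ℝ V]
  [NormedAddCommGroup E] [NormedSpace ℝ E]

/-- The Euler scheme for `dy = σ(y) dx` along the grid `u`. -/
def eulerScheme (σ : E → V →L[ℝ] E) (x : ℝ → V) (ξ : E) (u : ℕ → ℝ) : ℕ → E
  | 0 => ξ
  | k + 1 => eulerScheme σ x ξ u k + σ (eulerScheme σ x ξ u k) (x (u (k + 1)) - x (u k))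

/-- On scales below `T` one factor `h ^ α` absorbs `C`, so the resulting Hölder constant does not
involve `C`. -/
theorem norm_le_of_remainder {E : Type*} [NormedAddCommGroup E] {C D T h α : ℝ}
    {v r : E} (hα : 0 ≤ α) (hC : 0 ≤ C) (h0 : 0 ≤ h)
    (hhT : h ≤ T) (hT : C * T ^ α ≤ 1) (hr : ‖v - r‖ ≤ C * h ^ (2 * α)) (hr' : ‖r‖ ≤ D * h ^ α) :
    ‖v‖ ≤ (1 + D) * h ^ α := by
  have hh : 0 ≤ h ^ α := Real.rpow_nonneg h0 _
  have e : h ^ (2 * α) = h ^ α * h ^ α := by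
    rw [two_mul, Real.rpow_add_of_nonneg h0 hα hα]
  have h1 : C * h ^ α ≤ 1 := le_trans (by gcongr) hT
  calc ‖v‖ ≤ ‖v - r‖ + ‖r‖ := by simpa using norm_add_le (v - r) r
    _ ≤ (C * h ^ α) * h ^ α + D * h ^ α := by rw [e, ← mul_assoc] at hr; exact add_le_add hr hr'
    _ ≤ 1 * h ^ α + D * h ^ α := by gcongr
    _ = _ := by ring

variable {σ : E → V →L[ℝ] E} {L : ℝ} {x : ℝ → V} {α K T a b : ℝ}

theorem CoeffBound.norm_apply_increment_le (hσ : CoeffBound σ L) (hx : HolderBound α K a b x)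
    (p : E) {s t : ℝ} (hs : a ≤ s) (hst : s ≤ t) (ht : t ≤ b) :
    ‖σ p (x t - x s)‖ ≤ L * K * (t - s) ^ α := by
  refine (ContinuousLinearMap.le_opNorm _ _).trans ?_
  rw [mul_assoc]
  have := hσ.nonneg
  gcongr
  · exact hσ.norm_le p
  · exact hx s t hs hst ht

/-- The remainder vanishes on single steps. Its defect at `l` needs a Hölder bound for the scheme on
`[i, l]`, which the remainder bound already obtained there supplies; this is why `bisection_bound`
has a conditional hypothesis. -/
theorem eulerScheme_remainder_le (hσ : CoeffBound σ L) (ξ : E) {u : ℕ → ℝ} (hα : 1 / 2 < α)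
    (hK : 0 ≤ K) (hx : HolderBound α K a b x) (hu : Monotone u) (hua : ∀ k, a ≤ u k)
    (hub : ∀ k, u k ≤ b) (hT : sewingConst (2 * α) * (L * (1 + L * K) * K) * T ^ α ≤ 1)
    {i j : ℕ} (hij : i ≤ j) (hijT : u j - u i ≤ T) :
    ‖eulerScheme σ x ξ u j - eulerScheme σ x ξ u i -
        σ (eulerScheme σ x ξ u i) (x (u j) - x (u i))‖ ≤
      sewingConst (2 * α) * (L * (1 + L * K) * K) * (u j - u i) ^ (2 * α) := by
  have hL := hσ.nonneg
  have hθ : 1 < 2 * α := by linarith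
  have hD : 0 ≤ L * (1 + L * K) * K := by positivity
  have hC := mul_nonneg (sewingConst_nonneg hθ) hD
  refine bisection_bound hu (R := fun i j => ‖eulerScheme σ x ξ u j - eulerScheme σ x ξ u i -
        σ (eulerScheme σ x ξ u i) (x (u j) - x (u i))‖) hθ hD hC (sewingConst_eq hθ _).le
    (by simp) (by simp [eulerScheme]) ?_ i j hij hijT
  intro i l j hil hlj hT' hR
  set Y := eulerScheme σ x ξ u
  have m1 := hu hil
  have m2 := hu hlj
  have hl : ‖Y l - Y i‖ ≤ (1 + L * K) * (u l - u i) ^ α :=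
    norm_le_of_remainder (by linarith) hC (by linarith) (by linarith) hT hR
      (hσ.norm_apply_increment_le hx _ (hua _) m1 (hub _))
  have e : Y j - Y i - σ (Y i) (x (u j) - x (u i)) =
      (Y l - Y i - σ (Y i) (x (u l) - x (u i))) + (Y j - Y l - σ (Y l) (x (u j) - x (u l))) +
        (σ (Y l) - σ (Y i)) (x (u j) - x (u l)) := by
    simp only [map_sub, sub_apply]
    abel
  simp only [e]
  refine (norm_add₃_le).trans ?_
  gcongr
  have p1 : 0 ≤ u l - u i := by linarith
  have p2 : 0 ≤ u j - u l := by linarith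
  have p3 : 0 ≤ u j - u i := by linarith
  calc _ ≤ ‖σ (Y l) - σ (Y i)‖ * ‖x (u j) - x (u l)‖ := ContinuousLinearMap.le_opNorm _ _
    _ ≤ (L * ((1 + L * K) * (u l - u i) ^ α)) * (K * (u j - u l) ^ α) := by
      gcongr
      · exact (hσ.lipschitz _ _).trans (by gcongr)
      · exact hx _ _ (hua _) m2 (hub _)
    _ ≤ (L * ((1 + L * K) * (u j - u i) ^ α)) * (K * (u j - u i) ^ α) := by gcongr
    _ = _ := by
      rw [two_mul, Real.rpow_add_of_nonneg p3 (by linarith) (by linarith)]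
      ring

theorem norm_eulerScheme_sub_le (hσ : CoeffBound σ L) (ξ : E) {u : ℕ → ℝ} (hα : 1 / 2 < α)
    (hK : 0 ≤ K) (hx : HolderBound α K a b x) (hu : Monotone u) (hua : ∀ k, a ≤ u k)
    (hub : ∀ k, u k ≤ b) (hT : sewingConst (2 * α) * (L * (1 + L * K) * K) * T ^ α ≤ 1)
    {i j : ℕ} (hij : i ≤ j) (hijT : u j - u i ≤ T) :
    ‖eulerScheme σ x ξ u j - eulerScheme σ x ξ u i‖ ≤ (1 + L * K) * (u j - u i) ^ α := by
  have hL := hσ.nonneg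
  exact norm_le_of_remainder (by linarith)
    (mul_nonneg (sewingConst_nonneg (by linarith)) (by positivity)) (sub_nonneg.2 (hu hij)) hijT hT
    (eulerScheme_remainder_le hσ ξ hα hK hx hu hua hub hT hij hijT)
    (hσ.norm_apply_increment_le hx _ (hua _) (hu hij) (hub _))

/-- The grid on `[a, b]` with mesh `T / (n + 1)`. -/
noncomputable def grid (a b T : ℝ) (n k : ℕ) : ℝ := min (a + k * (T / (n + 1))) b

theorem grid_monotone (hT : 0 ≤ T) (n : ℕ) : Monotone (grid a b T n) := fun i j hij => by
  unfold grid; gcongr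

theorem le_grid (hT : 0 ≤ T) (hab : a ≤ b) (n k : ℕ) : a ≤ grid a b T n k :=
  le_min (le_add_of_nonneg_right (by positivity)) hab

theorem grid_le (n k : ℕ) : grid a b T n k ≤ b := min_le_right _ _

theorem grid_add_sub_le (hT : 0 ≤ T) (n i k : ℕ) :
    grid a b T n (i + k) - grid a b T n i ≤ k * (T / (n + 1)) := by
  have h : 0 ≤ k * (T / (n + 1)) := by positivity
  rw [sub_le_iff_le_add, grid, grid, ← min_add_add_left]
  refine min_le_min (le_of_eq ?_) (by linarith)
  push_cast; ring

/-- A block of `n + 1` steps spans time at most `T`; counting blocks gives a bound uniform in `n`,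
hence compactness. -/
theorem norm_eulerScheme_grid_sub_le (hσ : CoeffBound σ L) (ξ : E) (hα : 1 / 2 < α)
    (hK : 0 ≤ K) (hx : HolderBound α K a b x) (hab : a ≤ b) (hT0 : 0 ≤ T)
    (hT : sewingConst (2 * α) * (L * (1 + L * K) * K) * T ^ α ≤ 1) (n q : ℕ) :
    ∀ j ≤ q * (n + 1), ‖eulerScheme σ x ξ (grid a b T n) j - ξ‖ ≤ q * ((1 + L * K) * T ^ α) := by
  have hL := hσ.nonneg
  induction q with
  | zero =>
    intro j hj
    have : j = 0 := by omega
    subst this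
    simp [eulerScheme]
  | succ q ih =>
    intro j hj
    obtain ⟨i, k, rfl, hi, hk⟩ : ∃ i k, j = i + k ∧ i ≤ q * (n + 1) ∧ k ≤ n + 1 := by
      -- Truncated subtraction: for `j < n + 1` the block starts at `0`.
      refine ⟨j - (n + 1), j - (j - (n + 1)), by omega, ?_, by omega⟩
      rw [add_mul] at hj; omega
    have hmono := grid_monotone (a := a) (b := b) hT0 n
    have hstep : grid a b T n (i + k) - grid a b T n i ≤ T := by
      refine (grid_add_sub_le hT0 n i k).trans ?_
      have hk' : (k : ℝ) ≤ n + 1 := by exact_mod_cast hk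
      calc (k : ℝ) * (T / (n + 1)) ≤ (n + 1) * (T / (n + 1)) := by gcongr
        _ = T := by field_simp
    have A := norm_eulerScheme_sub_le hσ ξ hα hK hx hmono (le_grid hT0 hab n) (grid_le n) hT
      (Nat.le_add_right i k) hstep
    have B : (grid a b T n (i + k) - grid a b T n i) ^ α ≤ T ^ α :=
      Real.rpow_le_rpow (sub_nonneg.2 (hmono (Nat.le_add_right i k))) hstep (by linarith)
    calc ‖eulerScheme σ x ξ (grid a b T n) (i + k) - ξ‖
        ≤ ‖eulerScheme σ x ξ (grid a b T n) (i + k) - eulerScheme σ x ξ (grid a b T n) i‖ +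
          ‖eulerScheme σ x ξ (grid a b T n) i - ξ‖ := norm_sub_le_norm_sub_add_norm_sub _ _ _
      _ ≤ (1 + L * K) * T ^ α + q * ((1 + L * K) * T ^ α) :=
        add_le_add (A.trans (by gcongr)) (ih i hi)
      _ = _ := by push_cast; ring

/-- The last index of the grid of mesh `T / (n + 1)` not after `t`. -/
noncomputable def gridIndex (a T t : ℝ) (n : ℕ) : ℕ := ⌊(t - a) / T * (n + 1)⌋₊

theorem tendsto_grid_gridIndex (hT : 0 < T) {t : ℝ} (ha : a ≤ t) (hb : t ≤ b) :
    Tendsto (fun n => grid a b T n (gridIndex a T t n)) atTop (𝓝 t) := by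
  have h0 : Tendsto (fun n : ℕ => t - T / ((n : ℝ) + 1)) atTop (𝓝 t) := by
    have := (tendsto_one_div_add_atTop_nhds_zero_nat (𝕜 := ℝ)).const_mul T
    simpa [div_eq_mul_inv] using this.const_sub t
  have key : ∀ n : ℕ, 0 ≤ (t - a) / T * ((n : ℝ) + 1) := fun n =>
    mul_nonneg (div_nonneg (by linarith) hT.le) (by positivity)
  refine tendsto_of_tendsto_of_tendsto_of_le_of_le h0 tendsto_const_nhds (fun n => ?_) (fun n => ?_)
  · have hn : (0 : ℝ) < n + 1 := by positivity
    have h1 := (Nat.lt_floor_add_one ((t - a) / T * ((n : ℝ) + 1))).le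
    have h2 : (t - a) / T * ((n : ℝ) + 1) * (T / (n + 1)) = t - a := by field_simp
    have h3 := mul_le_mul_of_nonneg_right h1 (div_pos hT hn).le
    rw [h2] at h3
    have h4 : 0 < T / ((n : ℝ) + 1) := div_pos hT hn
    refine le_min ?_ (by linarith)
    simp only [gridIndex]
    linarith
  · have hn : (0 : ℝ) < n + 1 := by positivity
    have h1 := Nat.floor_le (key n)
    have h2 : (t - a) / T * ((n : ℝ) + 1) * (T / (n + 1)) = t - a := by field_simp
    have h3 := mul_le_mul_of_nonneg_right h1 (div_pos hT hn).le
    rw [h2] at h3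
    refine (min_le_left _ _).trans ?_
    simp only [gridIndex]
    linarith

theorem exists_gridIndex_le (a T t : ℝ) :
    ∃ q : ℕ, ∀ n, gridIndex a T t n ≤ q * (n + 1) := by
  obtain ⟨q, hq⟩ := exists_nat_ge ((t - a) / T)
  refine ⟨q, fun n => Nat.floor_le_of_le ?_⟩
  push_cast
  gcongr

theorem gridIndex_mono (hT : 0 < T) {s t : ℝ} (hst : s ≤ t) (n : ℕ) :
    gridIndex a T s n ≤ gridIndex a T t n := by
  unfold gridIndex; gcongr

theorem HolderBound.continuousOn {E : Type*} [NormedAddCommGroup E] {y : ℝ → E} {L : ℝ}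
    (hα : 0 < α) (hy : HolderBound α L a b y) : ContinuousOn y (Icc a b) := by
  intro t ht
  have hlim : Tendsto (fun s => L * |s - t| ^ α) (𝓝[Icc a b] t) (𝓝 0) := by
    have h : Continuous fun s : ℝ => L * |s - t| ^ α :=
      continuous_const.mul ((continuous_id.sub continuous_const).abs.rpow_const
        fun _ => Or.inr hα.le)
    have := h.tendsto t
    simp only [sub_self, abs_zero, Real.zero_rpow hα.ne', mul_zero] at this
    exact this.mono_left nhdsWithin_le_nhds
  refine tendsto_iff_norm_sub_tendsto_zero.2 (squeeze_zero' (.of_forall fun _ => norm_nonneg _) ?_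
    hlim)
  filter_upwards [self_mem_nhdsWithin] with s hs
  rcases le_total s t with h | h
  · rw [norm_sub_rev, abs_sub_comm, abs_of_nonneg (sub_nonneg.2 h)]
    exact hy s t hs.1 h ht.2
  · rw [abs_of_nonneg (sub_nonneg.2 h)]
    exact hy t s ht.1 h hs.2

/-- In finite dimension the bounded schemes converge along one ultrafilter at every time at once, so
no diagonal subsequence is needed; the remainder bound is closed under this limit. -/
theorem exists_local_young_path [FiniteDimensional ℝ E] (hσ : CoeffBound σ L) (ξ : E)
    (hα : 1 / 2 < α) (hK : 0 ≤ K) (hx : HolderBound α K a b x) (hab : a ≤ b) (hT0 : 0 < T)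
    (hT : sewingConst (2 * α) * (L * (1 + L * K) * K) * T ^ α ≤ 1) :
    ∃ y : ℝ → E, y a = ξ ∧ ∀ s t, a ≤ s → s ≤ t → t ≤ b → t - s < T →
      ‖y t - y s - σ (y s) (x t - x s)‖ ≤
        sewingConst (2 * α) * (L * (1 + L * K) * K) * (t - s) ^ (2 * α) := by
  have hL := hσ.nonneg
  have hproper : ProperSpace E := FiniteDimensional.proper_real E
  set u : ℕ → ℕ → ℝ := grid a b T
  set Y : ℝ → ℕ → E := fun t n => eulerScheme σ x ξ (u n) (gridIndex a T t n) with hY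
  set U : Ultrafilter ℕ := hyperfilter ℕ
  have hU : (U : Filter ℕ) ≤ atTop := Nat.hyperfilter_le_atTop
  have hlim : ∀ t, ∃ p, Tendsto (Y t) U (𝓝 p) := by
    intro t
    obtain ⟨q, hq⟩ := exists_gridIndex_le a T t
    have hball : ∀ n, Y t n ∈ Metric.closedBall ξ (q * ((1 + L * K) * T ^ α)) := fun n =>
      mem_closedBall_iff_norm.2
        (norm_eulerScheme_grid_sub_le hσ ξ hα hK hx hab hT0.le hT n q _ (hq n))
    obtain ⟨p, -, hp⟩ := (isCompact_closedBall ξ (q * ((1 + L * K) * T ^ α))).ultrafilter_le_nhds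
      (U.map (Y t)) (le_principal_iff.2 (Filter.mem_map.2 (univ_mem' hball)))
    exact ⟨p, hp⟩
  choose y hy using hlim
  have hσc : Continuous σ := by
    refine LipschitzWith.continuous (K := ⟨L, hL⟩) (LipschitzWith.of_dist_le_mul fun p q => ?_)
    rw [dist_eq_norm, dist_eq_norm]
    exact hσ.lipschitz p q
  have hgrid : ∀ t, a ≤ t → t ≤ b → Tendsto (fun n => u n (gridIndex a T t n)) U (𝓝 t) :=
    fun t ha hb => (tendsto_grid_gridIndex hT0 ha hb).mono_left hU
  have hxlim : ∀ t, a ≤ t → t ≤ b → Tendsto (fun n => x (u n (gridIndex a T t n))) U (𝓝 (x t)) := by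
    intro t ha hb
    refine (hx.continuousOn (by linarith) t ⟨ha, hb⟩).tendsto.comp
      (tendsto_nhdsWithin_iff.2 ⟨hgrid t ha hb, .of_forall fun n => ?_⟩)
    exact ⟨le_grid hT0.le hab _ _, grid_le _ _⟩
  refine ⟨y, ?_, fun s t hs hst ht htT => ?_⟩
  · refine tendsto_nhds_unique (hy a) (tendsto_const_nhds.congr fun n => ?_)
    simp [hY, gridIndex, eulerScheme]
  -- Strictness of `t - s < T` lets the approximating grid points eventually satisfy it too.
  · have htT' : ∀ᶠ n in (U : Filter ℕ),
        u n (gridIndex a T t n) - u n (gridIndex a T s n) < T :=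
      ((hgrid t (hs.trans hst) ht).sub (hgrid s hs (hst.trans ht))).eventually (gt_mem_nhds htT)
    have l0 : Tendsto (fun n => σ (Y s n)) U (𝓝 (σ (y s))) := (hσc.tendsto _).comp (hy s)
    have l1 := ((hy t).sub (hy s)).sub
      (((isBoundedBilinearMap_apply (𝕜 := ℝ) (E := V) (F := E)).continuous.tendsto _).comp
        (l0.prodMk_nhds ((hxlim t (hs.trans hst) ht).sub (hxlim s hs (hst.trans ht)))))
    have l2 := (((hgrid t (hs.trans hst) ht).sub (hgrid s hs (hst.trans ht))).rpow_const
      (p := 2 * α) (Or.inr (by linarith))).const_mul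
        (sewingConst (2 * α) * (L * (1 + L * K) * K))
    refine le_of_tendsto_of_tendsto l1.norm l2 ?_
    filter_upwards [htT'] with n hn
    exact eulerScheme_remainder_le hσ ξ hα hK hx (grid_monotone hT0.le n) (le_grid hT0.le hab n)
      (grid_le n) hT (gridIndex_mono hT0 hst n) hn.le

/-- The local bound gives continuity, hence boundedness by some `M` on the compact interval;
increments over length at least `T` then cost at most `2 * M / T ^ α`. -/
theorem HolderBound.of_local {E : Type*} [NormedAddCommGroup E] {y : ℝ → E} {C : ℝ}
    (hα : 0 < α) (hC : 0 ≤ C) (hT : 0 < T)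
    (h : ∀ s t, a ≤ s → s ≤ t → t ≤ b → t - s < T → ‖y t - y s‖ ≤ C * (t - s) ^ α) :
    ∃ C', 0 ≤ C' ∧ HolderBound α C' a b y := by
  have hc : ContinuousOn y (Icc a b) := by
    intro t ht
    have hloc : HolderBound α C (max a (t - T / 3)) (min b (t + T / 3)) y := by
      intro s r hs hsr hr
      have := max_le_iff.1 hs
      have := le_min_iff.1 hr
      exact h s r (by linarith) hsr (by linarith) (by linarith)
    have hmem : t ∈ Icc (max a (t - T / 3)) (min b (t + T / 3)) :=
      ⟨max_le ht.1 (by linarith), le_min ht.2 (by linarith)⟩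
    refine (hloc.continuousOn hα t hmem).mono_of_mem_nhdsWithin ?_
    filter_upwards [self_mem_nhdsWithin, mem_nhdsWithin_of_mem_nhds
      (Icc_mem_nhds (show t - T / 3 < t by linarith) (show t < t + T / 3 by linarith))] with r h1 h2
    exact ⟨max_le h1.1 h2.1, le_min h1.2 h2.2⟩
  obtain ⟨M, hM⟩ := isCompact_Icc.exists_bound_of_continuousOn hc
  have hTα : 0 < T ^ α := Real.rpow_pos_of_pos hT _
  refine ⟨max C (2 * M / T ^ α), le_max_of_le_left hC, fun s t hs hst ht => ?_⟩
  rcases lt_or_ge (t - s) T with hlt | hge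
  · exact (h s t hs hst ht hlt).trans
      (mul_le_mul_of_nonneg_right (le_max_left _ _) (Real.rpow_nonneg (by linarith) _))
  · have h1 := hM s ⟨hs, hst.trans ht⟩
    have h2 := hM t ⟨hs.trans hst, ht⟩
    have hM0 : 0 ≤ M := (norm_nonneg _).trans h1
    calc ‖y t - y s‖ ≤ ‖y t‖ + ‖y s‖ := norm_sub_le _ _
      _ ≤ 2 * M := by linarith
      _ = 2 * M / T ^ α * T ^ α := by field_simp
      _ ≤ 2 * M / T ^ α * (t - s) ^ α := by gcongr
      _ ≤ _ := mul_le_mul_of_nonneg_right (le_max_right _ _) (Real.rpow_nonneg (by linarith) _)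

theorem exists_isYoungSolution [FiniteDimensional ℝ E] (hσ : CoeffBound σ L) (ξ : E)
    (hα : 1 / 2 < α) (hK : 0 ≤ K) (hx : HolderBound α K a b x) (hab : a ≤ b) :
    ∃ y : ℝ → E, (∃ C, 0 ≤ C ∧ HolderBound α C a b y) ∧ IsYoungSolution σ x a b ξ y := by
  have hL := hσ.nonneg
  obtain ⟨T, hT0, -, hT⟩ := exists_mul_rpow_le (α := α)
    (A := sewingConst (2 * α) * (L * (1 + L * K) * K)) (by linarith) one_pos
  have hC : 0 ≤ sewingConst (2 * α) * (L * (1 + L * K) * K) :=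
    mul_nonneg (sewingConst_nonneg (by linarith)) (by positivity)
  obtain ⟨y, hya, hy⟩ := exists_local_young_path hσ ξ hα hK hx hab hT0 hT
  refine ⟨y, HolderBound.of_local (C := 1 + L * K) (by linarith) (by positivity) hT0
    fun s t hs hst ht htT => ?_, hya, fun t ht => ?_⟩
  · exact norm_le_of_remainder (by linarith) hC (by linarith) htT.le hT (hy s t hs hst ht htT)
      (hσ.norm_apply_increment_le hx _ hs hst ht)
  · rw [← hya]
    exact hasYoungIntegral_of_local (θ := 2 * α) (by linarith) hC hT0
      fun s r hs hsr hr hT => hy s r hs hsr (hr.trans ht.2) hT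

end Euler

/-! ### Hölder regularity of fractional Brownian paths -/

section Kolmogorov

open Filter Topology

/-- The dyadic approximation of level `n` from below. -/
noncomputable def dyadicFloor (t : ℝ) (n : ℕ) : ℝ := ⌊t * 2 ^ n⌋ / 2 ^ n

theorem tendsto_dyadicFloor (t : ℝ) : Tendsto (dyadicFloor t) atTop (𝓝 t) := by
  have h0 : Tendsto (fun n : ℕ => t - (1 / 2 : ℝ) ^ n) atTop (𝓝 t) := by
    simpa using (tendsto_pow_atTop_nhds_zero_of_lt_one (r := (1 / 2 : ℝ)) (by norm_num)
      (by norm_num)).const_sub t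
  refine tendsto_of_tendsto_of_tendsto_of_le_of_le h0 tendsto_const_nhds (fun n => ?_) fun n => ?_
  · have h2 : (0 : ℝ) < 2 ^ n := by positivity
    simp only [dyadicFloor]
    rw [le_div_iff₀ h2, sub_mul, ← mul_pow]
    norm_num
    linarith [Int.lt_floor_add_one (t * 2 ^ n)]
  · have h2 : (0 : ℝ) < 2 ^ n := by positivity
    simp only [dyadicFloor]
    rw [div_le_iff₀ h2]
    exact Int.floor_le _

/-- A continuous function whose dyadic increments satisfy a Hölder bound is Hölder continuous. -/
theorem exists_holderBound_of_dyadic {f : ℝ → ℝ} (hf : Continuous f) {α C : ℝ} (hα : 0 < α)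
    (hC : 0 ≤ C) (N : ℕ) (h : ∀ (n : ℕ) (k : ℤ), -(N * 2 ^ n) ≤ k → k ≤ N * 2 ^ n →
      |f ((k + 1) / 2 ^ n) - f (k / 2 ^ n)| ≤ C * ((1 / 2 : ℝ) ^ α) ^ n)
    {a b : ℝ} (ha : -N ≤ a) (hb : b < N) : ∃ K, 0 ≤ K ∧ HolderBound α K a b f := by
  set r : ℝ := (1 / 2 : ℝ) ^ α with hr
  have hr0 : 0 < r := Real.rpow_pos_of_pos (by norm_num) _
  have hr1 : r < 1 := Real.rpow_lt_one (by norm_num) (by norm_num) hα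
  have hr1' : 0 < 1 - r := by linarith
  have hrange : ∀ t, a ≤ t → t ≤ b → ∀ n : ℕ, -(N * 2 ^ n : ℤ) ≤ ⌊t * 2 ^ n⌋ ∧
      ⌊t * 2 ^ n⌋ < (N * 2 ^ n : ℤ) := by
    intro t hat htb n
    have h2 : (0 : ℝ) < 2 ^ n := by positivity
    constructor
    · rw [Int.le_floor]; push_cast; nlinarith
    · rw [Int.floor_lt]; push_cast; nlinarith
  have hstep : ∀ t, a ≤ t → t ≤ b → ∀ n,
      dist (f (dyadicFloor t n)) (f (dyadicFloor t (n + 1))) ≤ C * r ^ n := by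
    intro t hat htb n
    obtain ⟨g1, g2⟩ := hrange t hat htb n
    have h2 : (0 : ℝ) < 2 ^ n := by positivity
    set k := ⌊t * 2 ^ n⌋ with hk
    -- Consecutive dyadic approximations coincide or are neighbours at level `n + 1`, so the
    -- increments telescope geometrically.
    have e1 : (2 * k : ℤ) ≤ ⌊t * 2 ^ (n + 1)⌋ := by
      rw [Int.le_floor, pow_succ]; push_cast
      linarith [Int.floor_le (t * 2 ^ n)]
    have e2 : ⌊t * 2 ^ (n + 1)⌋ < 2 * k + 2 := by
      rw [Int.floor_lt, pow_succ]; push_cast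
      linarith [Int.lt_floor_add_one (t * 2 ^ n)]
    have e3 : dyadicFloor t n = ((2 * k : ℤ) : ℝ) / 2 ^ (n + 1) := by
      simp only [dyadicFloor, ← hk, pow_succ]; push_cast; field_simp
    rcases (show ⌊t * 2 ^ (n + 1)⌋ = 2 * k ∨ ⌊t * 2 ^ (n + 1)⌋ = 2 * k + 1 by omega) with e | e
    · rw [e3, dyadicFloor, e, dist_self]; positivity
    · rw [e3, dyadicFloor, e, dist_comm, Real.dist_eq]
      push_cast
      have := h (n + 1) (2 * k) (by rw [pow_succ]; linarith) (by rw [pow_succ]; linarith)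
      push_cast at this
      refine this.trans ?_
      rw [pow_succ]
      have : r ^ n * r ≤ r ^ n := mul_le_of_le_one_right (by positivity) hr1.le
      gcongr
  have hlim : ∀ t, a ≤ t → t ≤ b → ∀ n, dist (f (dyadicFloor t n)) (f t) ≤ C * r ^ n / (1 - r) :=
    fun t hat htb n => dist_le_of_le_geometric_of_tendsto r C hr1 (hstep t hat htb)
      ((hf.tendsto t).comp (tendsto_dyadicFloor t)) n
  refine HolderBound.of_local (C := C * (1 + 2 / (1 - r)) * 2 ^ α) hα (by positivity) one_pos
    fun s t hs hst ht hlt => ?_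
  rcases hst.eq_or_lt with rfl | hst'
  · simp [Real.zero_rpow hα.ne']
  -- The level `n` is the scale of the increment: `(1 / 2) ^ (n + 1) < t - s ≤ (1 / 2) ^ n`.
  obtain ⟨n, hn1, hn2⟩ := exists_nat_pow_near_of_lt_one (sub_pos.2 hst') hlt.le
    (one_half_pos (α := ℝ)) one_half_lt_one
  have h2 : (0 : ℝ) < 2 ^ n := by positivity
  have hrn : r ^ n ≤ 2 ^ α * (t - s) ^ α := by
    rw [hr, ← Real.rpow_mul_natCast (by norm_num), mul_comm α, Real.rpow_natCast_mul (by norm_num),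
      ← Real.mul_rpow (by norm_num) (by linarith)]
    refine Real.rpow_le_rpow (by positivity) ?_ hα.le
    rw [pow_succ] at hn1
    linarith
  have hmid : dist (f (dyadicFloor t n)) (f (dyadicFloor s n)) ≤ C * r ^ n := by
    obtain ⟨g1, g2⟩ := hrange s hs (hst.trans ht) n
    have e1 : ⌊s * 2 ^ n⌋ ≤ ⌊t * 2 ^ n⌋ := Int.floor_le_floor (by gcongr)
    have e2 : ⌊t * 2 ^ n⌋ < ⌊s * 2 ^ n⌋ + 2 := by
      have : (t - s) * 2 ^ n ≤ 1 := by
        calc (t - s) * 2 ^ n ≤ (1 / 2) ^ n * 2 ^ n := by gcongr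
          _ = 1 := by rw [← mul_pow]; norm_num
      rw [Int.floor_lt]; push_cast
      linarith [Int.lt_floor_add_one (s * 2 ^ n)]
    rcases (show ⌊t * 2 ^ n⌋ = ⌊s * 2 ^ n⌋ ∨ ⌊t * 2 ^ n⌋ = ⌊s * 2 ^ n⌋ + 1 by omega) with e | e
    · rw [dyadicFloor, dyadicFloor, e, dist_self]; positivity
    · rw [dyadicFloor, dyadicFloor, e, Real.dist_eq]
      push_cast
      exact h n _ g1 g2.le
  have l1 := hlim t (hs.trans hst) ht n
  have l2 := hlim s hs (hst.trans ht) n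
  rw [← dist_eq_norm]
  calc dist (f t) (f s) ≤ dist (f t) (f (dyadicFloor t n)) +
        dist (f (dyadicFloor t n)) (f (dyadicFloor s n)) + dist (f (dyadicFloor s n)) (f s) :=
        dist_triangle4 _ _ _ _
    _ ≤ C * r ^ n / (1 - r) + C * r ^ n + C * r ^ n / (1 - r) := by
        rw [dist_comm (f t)]; gcongr
    _ = C * (1 + 2 / (1 - r)) * r ^ n := by ring
    _ ≤ C * (1 + 2 / (1 - r)) * (2 ^ α * (t - s) ^ α) := by gcongr
    _ = _ := by ring

variable {Ω : Type*} [MeasurableSpace Ω] {P : Measure Ω} [IsProbabilityMeasure P] {H : ℝ}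
  {X : ℝ → Ω → ℝ}

theorem IsRealFBM.map_sub (hX : IsRealFBM H X P) (hH : 0 < H) (s t : ℝ) :
    P.map (X t - X s) = (gaussianReal 0 1).map (|t - s| ^ H * ·) := by
  have hg := hX.gaussian
  have hint : ∀ t, Integrable (X t) P := fun t => (hg.hasGaussianLaw_eval t).integrable
  have hm : ∀ t, MemLp (X t) 2 P := fun t => (hg.hasGaussianLaw_eval t).memLp_two
  have hmean : P[X t - X s] = 0 := by
    simp only [Pi.sub_apply]
    rw [integral_sub (hint t) (hint s), hX.centred, hX.centred, sub_zero]
  have hvar : Var[X t - X s; P] = (|t - s| ^ H) ^ 2 := by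
    rw [← covariance_self (hg.hasGaussianLaw_sub).aemeasurable,
      covariance_sub_sub (hm t) (hm s) (hm t) (hm s)]
    simp only [hX.covariance_eq, sub_self, abs_zero]
    rw [Real.zero_rpow (by linarith), abs_sub_comm s t, ← Real.rpow_mul_natCast (abs_nonneg _)]
    push_cast
    rw [mul_comm H 2]
    ring
  rw [(hg.hasGaussianLaw_sub (s := t) (t := s)).map_eq_gaussianReal, hmean, hvar,
    gaussianReal_map_const_mul]
  congr 1
  · simp
  · ext; simp [Real.coe_toNNReal _ (sq_nonneg (|t - s| ^ H))]

theorem IsRealFBM.lintegral_increment (hX : IsRealFBM H X P) (hH : 0 < H) (p : ℕ) (s t : ℝ) :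
    ∫⁻ ω, ‖X t ω - X s ω‖ₑ ^ p ∂P =
      ENNReal.ofReal (|t - s| ^ H) ^ p * ∫⁻ z, ‖z‖ₑ ^ p ∂(gaussianReal 0 1) := by
  have hm := (hX.gaussian.hasGaussianLaw_sub (s := t) (t := s)).aemeasurable
  have h1 : ∫⁻ ω, ‖X t ω - X s ω‖ₑ ^ p ∂P = ∫⁻ z, ‖z‖ₑ ^ p ∂(P.map (X t - X s)) := by
    rw [lintegral_map' (by fun_prop) hm]; rfl
  rw [h1, hX.map_sub hH, lintegral_map (by fun_prop) (by fun_prop),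
    ← lintegral_const_mul _ (by fun_prop)]
  refine lintegral_congr fun z => ?_
  rw [enorm_mul, mul_pow, Real.enorm_eq_ofReal (Real.rpow_nonneg (abs_nonneg _) _)]

theorem lintegral_gaussianReal_pow_lt_top (p : ℕ) :
    ∫⁻ z, ‖z‖ₑ ^ p ∂(gaussianReal 0 1) < ⊤ := by
  rcases Nat.eq_zero_or_pos p with rfl | hp
  · simp
  have := (memLp_id_gaussianReal (μ := 0) (v := 1) (p : ℝ≥0)).eLpNorm_lt_top
  have := lintegral_rpow_enorm_lt_top_of_eLpNorm_lt_top (by simpa using hp.ne') (by simp) this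
  simpa using this

/-- The sum of the `p`-th powers of all rescaled dyadic increments has finite mean, hence is almost
surely finite and bounds each increment. Continuity of the paths then passes from dyadic to all
times. -/
theorem IsRealFBM.ae_exists_holderBound (hX : IsRealFBM H X P) {α : ℝ} (hα : 0 < α) (hαH : α < H)
    (a b : ℝ) : ∀ᵐ ω ∂P, ∃ K, 0 ≤ K ∧ HolderBound α K a b (fun t => X t ω) := by
  have hH : 0 < H := hα.trans hαH
  obtain ⟨N, hN⟩ := exists_nat_gt (max (-a) b)
  -- Level `n` has about `2 ^ n` increments, each rescaled moment being of order `2 ^ ((α - H) * p *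
  -- n)`; this `p` makes the series geometric.
  obtain ⟨p, hp⟩ : ∃ p : ℕ, 2 * ((2 : ℝ) ^ (α - H)) ^ p < 1 := by
    have h1 : (2 : ℝ) ^ (α - H) < 1 := Real.rpow_lt_one_of_one_lt_of_neg (by norm_num) (by linarith)
    obtain ⟨p, hp⟩ := exists_pow_lt_of_lt_one (one_half_pos (α := ℝ)) h1
    exact ⟨p, by linarith⟩
  have hp0 : p ≠ 0 := by rintro rfl; norm_num at hp
  set c := ∫⁻ z, ‖z‖ₑ ^ p ∂(gaussianReal 0 1) with hc
  have hcfin : c < ⊤ := lintegral_gaussianReal_pow_lt_top p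
  let G : ℕ → ℤ → Ω → ENNReal := fun n k ω =>
    (ENNReal.ofReal (((2 : ℝ) ^ α) ^ n) * ‖X ((k + 1) / 2 ^ n) ω - X (k / 2 ^ n) ω‖ₑ) ^ p
  let I : ℕ → Finset ℤ := fun n => Finset.Icc (-(N * 2 ^ n)) (N * 2 ^ n)
  have hGm : ∀ n k, AEMeasurable (G n k) P := fun n k => by
    have h1 := hX.gaussian.aemeasurable ((k + 1) / 2 ^ n)
    have h2 := hX.gaussian.aemeasurable (k / 2 ^ n)
    exact ((h1.sub h2).enorm.const_mul _).pow_const p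
  have hGint : ∀ n k, ∫⁻ ω, G n k ω ∂P = ENNReal.ofReal (((2 : ℝ) ^ (α - H)) ^ p) ^ n * c := by
    intro n k
    simp only [G, mul_pow]
    rw [lintegral_const_mul' _ _ (by simp [ENNReal.pow_eq_top_iff]), hX.lintegral_increment hH,
      ← mul_assoc, ← mul_pow, ← ENNReal.ofReal_mul (by positivity), ← ENNReal.ofReal_pow
      (by positivity), ← ENNReal.ofReal_pow (by positivity)]
    congr 2
    rw [← pow_mul, mul_comm p n, pow_mul]
    congr 1
    have : ((k : ℝ) + 1) / 2 ^ n - k / 2 ^ n = (1 / 2) ^ n := by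
      rw [← sub_div, one_div, inv_pow]; ring
    rw [this, abs_of_pos (by positivity), ← Real.rpow_natCast_mul (by norm_num), mul_comm (n : ℝ) H,
      Real.rpow_mul_natCast (by norm_num), ← mul_pow, Real.rpow_sub (by norm_num), one_div,
      Real.inv_rpow (by norm_num), div_eq_mul_inv]
  have hcard : ∀ n, ((I n).card : ENNReal) ≤ (2 * N + 1) * 2 ^ n := by
    intro n
    have : (I n).card ≤ (2 * N + 1) * 2 ^ n := by
      simp only [I, Int.card_Icc]
      rw [Int.toNat_le]
      push_cast
      have : (1 : ℤ) ≤ 2 ^ n := one_le_pow₀ (by norm_num)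
      linarith
    exact_mod_cast this
  have hsum : ∫⁻ ω, ∑' n, ∑ k ∈ I n, G n k ω ∂P < ⊤ := by
    rw [lintegral_tsum fun n => Finset.aemeasurable_fun_sum _ fun k _ => hGm n k]
    set ρ : ENNReal := 2 * ENNReal.ofReal (((2 : ℝ) ^ (α - H)) ^ p) with hρ
    have hρ1 : ρ < 1 := by
      rw [hρ, ← ENNReal.ofReal_ofNat, ← ENNReal.ofReal_mul (by norm_num)]
      exact ENNReal.ofReal_lt_one.2 hp
    have hle : ∀ n, ∫⁻ ω, ∑ k ∈ I n, G n k ω ∂P ≤ (2 * N + 1) * c * ρ ^ n := by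
      intro n
      rw [lintegral_finsetSum' _ fun k _ => hGm n k]
      simp only [hGint, Finset.sum_const, nsmul_eq_mul]
      calc _ ≤ ((2 * N + 1) * 2 ^ n) * (ENNReal.ofReal (((2 : ℝ) ^ (α - H)) ^ p) ^ n * c) := by
            gcongr; exact hcard n
        _ = _ := by rw [hρ, mul_pow]; ring
    refine (ENNReal.tsum_le_tsum hle).trans_lt ?_
    rw [ENNReal.tsum_mul_left, ENNReal.tsum_geometric]
    refine ENNReal.mul_lt_top (ENNReal.mul_lt_top (by finiteness) hcfin) ?_
    exact ENNReal.inv_lt_top.2 (tsub_pos_of_lt hρ1)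
  have hae := ae_lt_top' (AEMeasurable.tsum fun n =>
    Finset.aemeasurable_fun_sum (I n) fun k _ => hGm n k) hsum.ne
  filter_upwards [hae, hX.continuous_paths] with ω hω hcont
  set Z := ∑' n, ∑ k ∈ I n, G n k ω
  have hZ : Z + 1 ≠ ⊤ := by finiteness
  refine exists_holderBound_of_dyadic hcont hα (C := (Z + 1).toReal) ENNReal.toReal_nonneg N
    (fun n k hk1 hk2 => ?_) (by linarith [le_max_left (-a) b]) ((le_max_right _ _).trans_lt hN)
  have h1 : G n k ω ≤ Z :=
    (Finset.single_le_sum (f := fun k => G n k ω) (fun _ _ => zero_le)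
      (Finset.mem_Icc.2 ⟨hk1, hk2⟩)).trans (ENNReal.le_tsum n)
  set e := ENNReal.ofReal (((2 : ℝ) ^ α) ^ n) * ‖X ((k + 1) / 2 ^ n) ω - X (k / 2 ^ n) ω‖ₑ with he
  -- Either `e ≤ 1` or `e ≤ e ^ p ≤ Z`; adding `1` avoids a `p`-th root.
  have h2 : e ≤ Z + 1 := by
    rcases le_total e 1 with h | h
    · exact h.trans le_add_self
    · exact (le_self_pow₀ h hp0).trans (h1.trans le_self_add)
  have h3 := ENNReal.toReal_mono hZ h2
  rw [he, ENNReal.toReal_mul, ENNReal.toReal_ofReal (by positivity), toReal_enorm,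
    Real.norm_eq_abs] at h3
  have h4 : (0 : ℝ) < ((2 : ℝ) ^ α) ^ n := by positivity
  rw [one_div, Real.inv_rpow (by norm_num), inv_pow, ← div_eq_mul_inv, le_div_iff₀ h4, mul_comm]
  exact h3

end Kolmogorov

/-! ### Vector-valued paths and conclusion -/

theorem EuclideanSpace.norm_le_sum_abs {d : ℕ} (v : EuclideanSpace ℝ (Fin d)) :
    ‖v‖ ≤ ∑ i, |v i| := by
  rw [EuclideanSpace.norm_eq]
  refine Real.sqrt_le_iff.2 ⟨Finset.sum_nonneg fun _ _ => abs_nonneg _, ?_⟩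
  exact Finset.sum_sq_le_sq_sum_of_nonneg fun _ _ => abs_nonneg _

theorem IsFBM.ae_exists_holderBound {Ω : Type*} [MeasurableSpace Ω] {P : Measure Ω}
    [IsProbabilityMeasure P] {d : ℕ} {H : ℝ} {B : ℝ → Ω → EuclideanSpace ℝ (Fin d)}
    (hB : IsFBM H B P) {α : ℝ} (hα : 0 < α) (hαH : α < H) (a b : ℝ) :
    ∀ᵐ ω ∂P, ∃ K, 0 ≤ K ∧ HolderBound α K a b (fun t => B t ω) := by
  filter_upwards [ae_all_iff.2 fun i => (hB.component i).ae_exists_holderBound hα hαH a b] with ω h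
  choose K hK0 hK using h
  refine ⟨∑ i, K i, Finset.sum_nonneg fun i _ => hK0 i, fun s t hs hst ht => ?_⟩
  rw [Finset.sum_mul]
  exact (EuclideanSpace.norm_le_sum_abs _).trans
    (Finset.sum_le_sum fun i _ => hK i s t hs hst ht)

theorem IsHolderPath.exists_holderBound {E : Type*} [NormedAddCommGroup E] {α : ℝ≥0} {a b : ℝ}
    {y : ℝ → E} (h : IsHolderPath α a b y) : ∃ C, 0 ≤ C ∧ HolderBound α C a b y := by
  obtain ⟨C, hC⟩ := h
  refine ⟨C, C.2, fun s t hs hst ht => ?_⟩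
  have := hC.dist_le (x := t) (y := s) ⟨hs.trans hst, ht⟩ ⟨hs, hst.trans ht⟩
  rwa [dist_eq_norm, Real.dist_eq, abs_of_nonneg (sub_nonneg.2 hst)] at this

theorem HolderBound.isHolderPath {E : Type*} [NormedAddCommGroup E] {α : ℝ≥0} {C a b : ℝ}
    {y : ℝ → E} (hC : 0 ≤ C) (h : HolderBound α C a b y) : IsHolderPath α a b y := by
  refine ⟨C.toNNReal, fun s hs t ht => ?_⟩
  have key : dist (y s) (y t) ≤ C * dist s t ^ (α : ℝ) := by
    rcases le_total s t with hst | hst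
    · rw [dist_comm, dist_eq_norm, dist_comm, Real.dist_eq, abs_of_nonneg (sub_nonneg.2 hst)]
      exact h s t hs.1 hst ht.2
    · rw [dist_eq_norm, Real.dist_eq, abs_of_nonneg (sub_nonneg.2 hst)]
      exact h t s ht.1 hst hs.2
  rw [edist_dist, edist_dist, ENNReal.ofReal_rpow_of_nonneg dist_nonneg α.coe_nonneg]
  refine (ENNReal.ofReal_le_ofReal key).trans_eq ?_
  rw [ENNReal.ofReal_mul hC]; rfl

theorem theoremA1 {Ω : Type*} [MeasurableSpace Ω] (P : Measure Ω) [IsProbabilityMeasure P]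
    {m d : ℕ} (H : ℝ) (hH : 1 / 2 < H) (hH1 : H < 1)
    (B : ℝ → Ω → EuclideanSpace ℝ (Fin d)) (hB : IsFBM H B P)
    (α : ℝ≥0) (hα : 1 / 2 < (α : ℝ)) (hαH : (α : ℝ) < H)
    (a b : ℝ) (hab : a ≤ b)
    (σ : EuclideanSpace ℝ (Fin m) → EuclideanSpace ℝ (Fin d) →L[ℝ] EuclideanSpace ℝ (Fin m))
    (hσ : IsCb3 σ) :
    ∀ᵐ ω ∂P, ∀ ξ : EuclideanSpace ℝ (Fin m),
      ∃ y : ℝ → EuclideanSpace ℝ (Fin m),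
        (IsHolderPath α a b y ∧ IsYoungSolution σ (fun t => B t ω) a b ξ y) ∧
        ∀ z : ℝ → EuclideanSpace ℝ (Fin m),
          IsHolderPath α a b z → IsYoungSolution σ (fun t => B t ω) a b ξ z →
            EqOn z y (Icc a b) := by
  obtain ⟨L, hL⟩ := hσ.coeffBound
  filter_upwards [hB.ae_exists_holderBound (by linarith) hαH a b] with ω ⟨K, hK, hx⟩ ξ
  obtain ⟨y, ⟨Cy, hCy, hy⟩, hys⟩ := exists_isYoungSolution hL ξ hα hK hx hab
  refine ⟨y, ⟨hy.isHolderPath hCy, hys⟩, fun z hz hzs => ?_⟩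
  obtain ⟨Cz, hCz, hz⟩ := hz.exists_holderBound
  exact IsYoungSolution.eqOn hL hα hK hCz hCy hx hz hy hzs hys
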